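/- Let $(W,S)$ be a Coxeter system with length function $\ell$, with $n(s,t)\in\{1,2,\dots,\infty\}$ the order of $st$ for $s,t\in S$, and let $H$ be its Hecke algebra over $\mathbb{Q}(u)$: the associative unital algebra with basis $\{T_w : w\in W\}$, unit $T_e$, and, for $s\in S$, $w\in W$, $T_sT_w=T_{sw}$ if $\ell(sw)>\ell(w)$ and $T_sT_w=u^2T_{sw}+(u^2-1)T_w$ if $\ell(sw)<\ell(w)$. An *$S$-labeled digraph* $\Gamma$ is a directed multigraph without loops in which each edge is solid or dashed and is labeled by an element of $S$, such that for every $s\in S$ each vertex occurs in exactly one edge labeled $s$. Let $M(\Gamma)$ be the $\mathbb{Q}(u)$-vector space with basis the vertices of $\Gamma$, and for $s\in S$ let $\tau_s$ be the linear operator on $M(\Gamma)$ such that for every edge labeled $s$ from $\alpha$ to $\beta$: if the edge is solid, $\tau_s\alpha=\beta$ and $\tau_s\beta=(u^2-1)\beta+u^2\alpha$; if it is dashed, $\tau_s\alpha=u\alpha+(u+1)\beta$ and $\tau_s\beta=(u^2-u-1)\beta+(u^2-u)\alpha$. $\Gamma$ is a *$W$-digraph* if $T_s\mapsto\tau_s$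 $(s\in S)$ extends to a representation of $H$ on $M(\Gamma)$; if $\Gamma$ also has finitely many vertices, $\chi_\Gamma$ denotes the character of this representation. $\Gamma_{\mathrm{rev}}$ is obtained from $\Gamma$ by reversing all edges, keeping their types and labels. $\Gamma$ is *acyclic* if it has no nonempty directed circuit (edges of both types and all labels allowed). **Theorem.** Let $\Gamma$ be a $W$-digraph with finitely many vertices. Then $\Gamma_{\mathrm{rev}}$ is also a $W$-digraph, and the following hold. (i) If $\sigma$ is the automorphism of $\mathbb{Q}(u)$ determined by $\sigma(u)=-1/u$, then $\chi_{\Gamma_{\mathrm{rev}}}(T_w)=\sigma\bigl(\chi_\Gamma(T_{w^{-1}}^{-1})\bigr)$ for all $w\in W$. (ii) If $n(s,t)<\infty$ for all $s,t\in S$ and $\Gamma$ is acyclic, then $\chi_{\Gamma_{\mathrm{rev}}}(T_w)=(-1)^{\ell(w)}u^{2\ell(w)}\chi_\Gamma(T_w^{-1})$ for all $w\in W$. -/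

import Mathlib

/-! ### The coefficient field `ℚ(u)` and its automorphism `u ↦ -1/u` -/

/-- The field `ℚ(u)` of rational functions in one indeterminate. -/
abbrev QU : Type := RatFunc ℚ

/-- The indeterminate `u`. -/
noncomputable def qu : QU := RatFunc.X

theorem qu_ne_zero : qu ≠ 0 := RatFunc.X_ne_zero

theorem transcendental_neg_inv_qu : Transcendental ℚ (-qu⁻¹) := by
  intro h
  have h' : IsAlgebraic ℚ (-(-qu⁻¹))⁻¹ := h.neg.inv
  rw [neg_neg, inv_inv] at h'
  apply RatFunc.transcendental_X (K := ℚ)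
  convert h'
  · exact Subsingleton.elim _ _
  · rfl

theorem aeval_neg_inv_qu_injective :
    Function.Injective (Polynomial.aeval (R := ℚ) (-qu⁻¹)).toRingHom :=
  transcendental_iff_injective.mp transcendental_neg_inv_qu

/-- The endomorphism of `ℚ(u)` sending `u` to `-1/u`. -/
noncomputable def sigmaHom : QU →+* QU :=
  RatFunc.liftRingHom (Polynomial.aeval (R := ℚ) (-qu⁻¹)).toRingHom
    (nonZeroDivisors_le_comap_nonZeroDivisors_of_injective _ aeval_neg_inv_qu_injective)

theorem sigmaHom_qu : sigmaHom qu = -qu⁻¹ := by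
  have h := RatFunc.liftRingHom_X (Polynomial.aeval (R := ℚ) (-qu⁻¹)).toRingHom
    (nonZeroDivisors_le_comap_nonZeroDivisors_of_injective _ aeval_neg_inv_qu_injective)
  exact h.trans (Polynomial.aeval_X _)

theorem sigmaHom_comp_sigmaHom : sigmaHom.comp sigmaHom = RingHom.id QU := by
  have h2 : sigmaHom (sigmaHom qu) = qu := by
    rw [sigmaHom_qu, map_neg, map_inv₀, sigmaHom_qu, inv_neg, inv_inv, neg_neg]
  have h3 : (sigmaHom.comp sigmaHom).comp (algebraMap (Polynomial ℚ) QU) =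
      algebraMap (Polynomial ℚ) QU := by
    ext
    · simp
    · simpa [qu] using h2
  ext x
  induction x using RatFunc.induction_on with
  | f p q hq =>
    have hp := DFunLike.congr_fun h3 p
    have hq := DFunLike.congr_fun h3 q
    simp only [RingHom.comp_apply] at hp hq
    simp only [RingHom.comp_apply, RingHom.id_apply, map_div₀, hp, hq]

/-- The automorphism `σ` of `ℚ(u)` determined by `u ↦ -1/u`. -/
noncomputable def sigma : QU ≃+* QU :=
  RingEquiv.ofRingHom sigmaHom sigmaHom sigmaHom_comp_sigmaHom sigmaHom_comp_sigmaHom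

theorem sigma_qu : sigma qu = -1 / qu := by
  have h : sigma qu = -qu⁻¹ := sigmaHom_qu
  rw [h, neg_div, one_div]

/-! ### The Hecke algebra of a Coxeter system -/

section Hecke

variable {S W : Type*} [Group W] {M : CoxeterMatrix S} (cs : CoxeterSystem M W)

/-- The defining relations of the Hecke algebra, between noncommutative polynomials in symbols
`T_w`, `w ∈ W`: `T_e = 1`, and for `s ∈ S`, `w ∈ W`,
`T_s T_w = T_{sw}` if `ℓ(sw) > ℓ(w)`, `T_s T_w = u² T_{sw} + (u² - 1) T_w` if `ℓ(sw) < ℓ(w)`. -/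
inductive HeckeRel : FreeAlgebra QU W → FreeAlgebra QU W → Prop
  | one : HeckeRel (FreeAlgebra.ι QU 1) 1
  | mul_of_lt (s : S) (w : W) (h : cs.length w < cs.length (cs.simple s * w)) :
      HeckeRel (FreeAlgebra.ι QU (cs.simple s) * FreeAlgebra.ι QU w)
        (FreeAlgebra.ι QU (cs.simple s * w))
  | mul_of_gt (s : S) (w : W) (h : cs.length (cs.simple s * w) < cs.length w) :
      HeckeRel (FreeAlgebra.ι QU (cs.simple s) * FreeAlgebra.ι QU w)
        (qu ^ 2 • FreeAlgebra.ι QU (cs.simple s * w) + (qu ^ 2 - 1) • FreeAlgebra.ι QU w)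

/-- The Hecke algebra `H` of `(W, S)` over `ℚ(u)`. That the `T_w` form a basis of it is proved
below (`heckeBasis`), so `H` is the algebra with basis `T_w`, `w ∈ W`, unit `T_e`, and the usual
rule for multiplication by `T_s` from the left. -/
abbrev HeckeAlgebra : Type _ := RingQuot (HeckeRel cs)

/-- The element `T_w` of the Hecke algebra. -/
noncomputable def heckeT (w : W) : HeckeAlgebra cs :=
  RingQuot.mkAlgHom QU (HeckeRel cs) (FreeAlgebra.ι QU w)

theorem heckeT_one : heckeT cs 1 = 1 := by
  have h := RingQuot.mkAlgHom_rel QU (HeckeRel.one (cs := cs))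
  simpa [heckeT] using h

theorem heckeT_mul_of_lt (s : S) (w : W) (h : cs.length w < cs.length (cs.simple s * w)) :
    heckeT cs (cs.simple s) * heckeT cs w = heckeT cs (cs.simple s * w) := by
  have h := RingQuot.mkAlgHom_rel QU (HeckeRel.mul_of_lt (cs := cs) s w h)
  simpa [heckeT] using h

theorem heckeT_mul_of_gt (s : S) (w : W) (h : cs.length (cs.simple s * w) < cs.length w) :
    heckeT cs (cs.simple s) * heckeT cs w =
      qu ^ 2 • heckeT cs (cs.simple s * w) + (qu ^ 2 - 1) • heckeT cs w := by
  have h := RingQuot.mkAlgHom_rel QU (HeckeRel.mul_of_gt (cs := cs) s w h)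
  simpa [heckeT] using h

theorem heckeT_simple_mul_self (s : S) :
    heckeT cs (cs.simple s) * heckeT cs (cs.simple s) =
      qu ^ 2 • (1 : HeckeAlgebra cs) + (qu ^ 2 - 1) • heckeT cs (cs.simple s) := by
  have h := heckeT_mul_of_gt cs s (cs.simple s) (by simp)
  rwa [cs.simple_mul_simple_self, heckeT_one] at h

/-- Induction along reduced expressions. -/
theorem coxeter_reduced_induction {p : W → Prop} (one : p 1)
    (step : ∀ (s : S) (w : W), cs.length w < cs.length (cs.simple s * w) → p w →
      p (cs.simple s * w)) (w : W) : p w := by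
  induction hn : cs.length w generalizing w with
  | zero => rw [cs.length_eq_zero_iff] at hn; rwa [hn]
  | succ n ih =>
    have hw : w ≠ 1 := by rintro rfl; simp at hn
    obtain ⟨s, hs⟩ := cs.exists_leftDescent_of_ne_one hw
    have h1 := (cs.isLeftDescent_iff).mp hs
    have h2 := step s (cs.simple s * w) (by rw [cs.simple_mul_simple_cancel_left]; omega)
      (ih _ (by omega))
    rwa [cs.simple_mul_simple_cancel_left] at h2

theorem isUnit_heckeT_simple (s : S) : IsUnit (heckeT cs (cs.simple s)) := by
  have h := heckeT_simple_mul_self cs s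
  have hu : (qu ^ 2)⁻¹ * qu ^ 2 = 1 := inv_mul_cancel₀ (pow_ne_zero 2 qu_ne_zero)
  refine ⟨⟨heckeT cs (cs.simple s),
    (qu ^ 2)⁻¹ • (heckeT cs (cs.simple s) - (qu ^ 2 - 1) • 1), ?_, ?_⟩, rfl⟩
  · rw [mul_smul_comm, mul_sub, h, mul_smul_comm, mul_one, add_sub_cancel_right, smul_smul, hu,
      one_smul]
  · rw [smul_mul_assoc, sub_mul, h, smul_mul_assoc, one_mul, add_sub_cancel_right, smul_smul, hu,
      one_smul]

/-- Every `T_w` is invertible. -/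
theorem isUnit_heckeT (w : W) : IsUnit (heckeT cs w) := by
  induction w using coxeter_reduced_induction cs with
  | one => rw [heckeT_one]; exact isUnit_one
  | step s w h ih => rw [← heckeT_mul_of_lt cs s w h]; exact (isUnit_heckeT_simple cs s).mul ih

/-- The inverse `T_w⁻¹` of `T_w` in the Hecke algebra. -/
noncomputable def heckeTInv (w : W) : HeckeAlgebra cs := ↑(isUnit_heckeT cs w).unit⁻¹

theorem heckeT_mul_heckeTInv (w : W) : heckeT cs w * heckeTInv cs w = 1 :=
  (isUnit_heckeT cs w).mul_val_inv

theorem heckeTInv_mul_heckeT (w : W) : heckeTInv cs w * heckeT cs w = 1 :=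
  (isUnit_heckeT cs w).val_inv_mul

/-- Algebra homomorphisms out of `H` are determined by the images of the `T_s`, `s ∈ S`. -/
theorem heckeAlgebra_algHom_ext {A : Type*} [Semiring A] [Algebra QU A]
    {f g : HeckeAlgebra cs →ₐ[QU] A}
    (h : ∀ s, f (heckeT cs (cs.simple s)) = g (heckeT cs (cs.simple s))) : f = g := by
  have key : ∀ w, f (heckeT cs w) = g (heckeT cs w) := by
    intro w
    induction w using coxeter_reduced_induction cs with
    | one => simp [heckeT_one]
    | step s w hs ih => rw [← heckeT_mul_of_lt cs s w hs, map_mul, map_mul, h, ih]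
  apply RingQuot.ringQuot_ext'
  ext w
  exact key w

/-! #### The `T_w` form a basis

The standard argument: operators of left and right multiplication by the generators on the free
module over `W` commute. -/

/-- `(r, e) ↦ (s r s, e + [r = s])`. -/
noncomputable def reflAct (s : S) (x : W × ZMod 2) : W × ZMod 2 :=
  open Classical in
  (cs.simple s * x.1 * cs.simple s, x.2 + if x.1 = cs.simple s then 1 else 0)

theorem reflAct_iterate (s t : S) (k : ℕ) (x : W × ZMod 2) :
    (reflAct cs s ∘ reflAct cs t)^[k] x =
      open Classical in
      ((cs.simple s * cs.simple t) ^ k * x.1 * ((cs.simple s * cs.simple t) ^ k)⁻¹,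
        x.2 + ∑ n ∈ Finset.range (2 * k),
          if x.1 = ((cs.simple s * cs.simple t) ^ n)⁻¹ * cs.simple t then 1 else 0) := by
  classical
  set a := cs.simple s with ha
  set b := cs.simple t with hb
  have haa : a * a = 1 := cs.simple_mul_simple_self s
  have hbb : b * b = 1 := cs.simple_mul_simple_self t
  have hai : a⁻¹ = a := cs.inv_simple s
  have hbi : b⁻¹ = b := cs.inv_simple t
  have hconj : ∀ n : ℕ, b * (a * b) ^ n = ((a * b) ^ n)⁻¹ * b := by
    intro n
    induction n with
    | zero => simp
    | succ n ih =>
      rw [pow_succ, ← mul_assoc, ih, mul_inv_rev, mul_inv_rev, hai, hbi]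
      have h1 : b * (a * b) = (a * b)⁻¹ * b := by rw [mul_inv_rev, hai, hbi, mul_assoc]
      rw [mul_assoc, h1, ← mul_assoc, ← mul_inv_rev, ← pow_succ', pow_succ, mul_inv_rev,
        mul_inv_rev, hai, hbi]
  have hkey : ∀ (n : ℕ) (r : W) (c : W),
      (a * b) ^ n * r * ((a * b) ^ n)⁻¹ = c ↔ r = ((a * b) ^ n)⁻¹ * c * (a * b) ^ n := by
    intro n r c
    constructor
    · rintro rfl; group
    · rintro rfl; group
  induction k with
  | zero => simp
  | succ k ih =>
    rw [Function.iterate_succ_apply', ih]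
    simp only [Function.comp, reflAct, ← ha, ← hb]
    have e1 : (a * b) ^ k * x.1 * ((a * b) ^ k)⁻¹ = b ↔ x.1 = ((a * b) ^ (2 * k))⁻¹ * b := by
      rw [hkey, mul_assoc, hconj, ← mul_assoc, ← mul_inv_rev, ← pow_add, two_mul]
    have e2 : b * ((a * b) ^ k * x.1 * ((a * b) ^ k)⁻¹) * b = a ↔
        x.1 = ((a * b) ^ (2 * k + 1))⁻¹ * b := by
      have this : ∀ y c : W, b * y * b = c ↔ y = b * c * b := by
        intro y c
        constructor
        · rintro rfl
          simp only [mul_assoc, hbb, mul_one]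
          rw [← mul_assoc b b, hbb, one_mul]
        · rintro rfl
          simp only [mul_assoc, hbb, mul_one]
          rw [← mul_assoc b b, hbb, one_mul]
      rw [this, hkey]
      have h3 : b * a * b = (a * b)⁻¹ * b := by rw [mul_inv_rev, hai, hbi]
      rw [h3, mul_assoc, mul_assoc, hconj, ← mul_assoc, ← mul_assoc, ← mul_inv_rev, ← mul_inv_rev,
        ← pow_succ', ← pow_add]
      rw [show k + (k + 1) = 2 * k + 1 by ring]
    refine Prod.ext ?_ ?_
    · simp only [pow_succ', mul_inv_rev, hai, hbi, mul_assoc]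
    · simp only [e1, e2]
      rw [show 2 * (k + 1) = 2 * k + 1 + 1 by ring, Finset.sum_range_succ, Finset.sum_range_succ]
      simp only [add_assoc]

/-- The map `reflAct` as an element of the monoid of self-maps. -/
noncomputable def reflEnd (s : S) : Function.End (W × ZMod 2) := reflAct cs s

theorem reflEnd_liftable : M.IsLiftable (reflEnd cs) := by
  classical
  intro s t
  have hpow : ∀ k : ℕ, (reflEnd cs s * reflEnd cs t) ^ k =
      (reflAct cs s ∘ reflAct cs t)^[k] := by
    intro k
    induction k with
    | zero => rfl
    | succ k ih => rw [pow_succ, ih]; rfl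
  rw [hpow]
  funext x
  refine (reflAct_iterate cs s t (M s t) x).trans ?_
  rw [cs.simple_mul_simple_pow, two_mul, Finset.sum_range_add]
  simp only [pow_add, cs.simple_mul_simple_pow, one_mul]
  rw [CharTwo.add_self_eq_zero, add_zero, inv_one, mul_one]
  rfl

/-- `(r, e) ↦ (w r w⁻¹, e + η(w, r))`. -/
noncomputable def reflHom : W →* Function.End (W × ZMod 2) :=
  cs.lift ⟨reflEnd cs, reflEnd_liftable cs⟩

theorem reflHom_one (x : W × ZMod 2) : reflHom cs 1 x = x := by
  rw [map_one]; rfl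

/-- The parity cocycle. -/
noncomputable def reflPar (w r : W) : ZMod 2 := (reflHom cs w (r, 0)).2

theorem reflHom_simple (s : S) (x : W × ZMod 2) :
    reflHom cs (cs.simple s) x = reflAct cs s x := by
  rw [reflHom, cs.lift_apply_simple]; rfl

theorem reflHom_apply (w : W) (x : W × ZMod 2) :
    reflHom cs w x = (w * x.1 * w⁻¹, x.2 + reflPar cs w x.1) := by
  induction w using coxeter_reduced_induction cs generalizing x with
  | one => simp [reflPar, reflHom_one]
  | step s w h ih =>
    have h1 : ∀ y, reflHom cs (cs.simple s * w) y = reflAct cs s (reflHom cs w y) := by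
      intro y
      rw [map_mul, ← reflHom_simple]; rfl
    rw [reflPar, h1, h1, ih, ih]
    simp [reflAct, mul_assoc, add_assoc]

theorem reflPar_mul (v w r : W) :
    reflPar cs (v * w) r = reflPar cs w r + reflPar cs v (w * r * w⁻¹) := by
  have : reflHom cs (v * w) (r, 0) = reflHom cs v (reflHom cs w (r, 0)) := by
    rw [map_mul]; rfl
  rw [reflPar, this, reflHom_apply, reflHom_apply]
  simp

theorem reflPar_one (r : W) : reflPar cs 1 r = 0 := by simp [reflPar, reflHom_one]

open Classical in
theorem reflPar_simple (s : S) (r : W) :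
    reflPar cs (cs.simple s) r = if r = cs.simple s then 1 else 0 := by
  rw [reflPar, reflHom_simple]; simp [reflAct]

theorem reflPar_self {r : W} (hr : cs.IsReflection r) : reflPar cs r r = 1 := by
  classical
  obtain ⟨v, s, rfl⟩ := hr
  have h0 := reflPar_mul cs v v⁻¹ (v * cs.simple s * v⁻¹)
  rw [mul_inv_cancel, reflPar_one] at h0
  rw [reflPar_mul cs (v * cs.simple s) v⁻¹, reflPar_mul cs v (cs.simple s)]
  have h1 : v⁻¹ * (v * cs.simple s * v⁻¹) * v⁻¹⁻¹ = cs.simple s := by group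
  rw [h1] at h0 ⊢
  have h2 : cs.simple s * cs.simple s * (cs.simple s)⁻¹ = cs.simple s := by group
  rw [h2, reflPar_simple, if_pos rfl]
  linear_combination -h0

theorem mem_rightInvSeq_of_reflPar (ω : List S) (r : W) (h : reflPar cs (cs.wordProd ω) r ≠ 0) :
    r ∈ cs.rightInvSeq ω := by
  classical
  induction ω with
  | nil => simp [reflPar_one] at h
  | cons i ω ih =>
    rw [cs.wordProd_cons, reflPar_mul, reflPar_simple] at h
    rw [CoxeterSystem.rightInvSeq, List.mem_cons]
    by_cases h1 : cs.wordProd ω * r * (cs.wordProd ω)⁻¹ = cs.simple i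
    · left; rw [← h1]; group
    · right; apply ih; simpa [h1] using h

theorem lt_of_reflPar_ne_zero {w r : W} (h : reflPar cs w r ≠ 0) :
    cs.length (w * r) < cs.length w := by
  obtain ⟨ω, hω, rfl⟩ := cs.exists_isReduced w
  exact (cs.isRightInversion_of_mem_rightInvSeq hω (mem_rightInvSeq_of_reflPar cs ω r h)).2

theorem reflPar_ne_zero_iff {w r : W} (hr : cs.IsReflection r) :
    reflPar cs w r ≠ 0 ↔ cs.length (w * r) < cs.length w := by
  refine ⟨lt_of_reflPar_ne_zero cs, fun h h0 => ?_⟩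
  have h1 : reflPar cs (w * r) r = 1 := by
    rw [reflPar_mul, reflPar_self cs hr, hr.inv, hr.mul_self, one_mul, h0, add_zero]
  have h2 := lt_of_reflPar_ne_zero cs (w := w * r) (r := r) (by rw [h1]; exact one_ne_zero)
  rw [mul_assoc, hr.mul_self, mul_one] at h2
  omega

theorem isLeftDescent_mul_simple_iff (i j : S) (w : W) (h : cs.simple i * w ≠ w * cs.simple j) :
    cs.IsLeftDescent (w * cs.simple j) i ↔ cs.IsLeftDescent w i := by
  classical
  have hr : cs.IsReflection (w⁻¹ * cs.simple i * w) := ⟨w⁻¹, i, by simp⟩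
  have hne : w⁻¹ * cs.simple i * w ≠ cs.simple j := by
    intro h1; apply h; rw [← h1]; group
  have hr' : cs.IsReflection (cs.simple j * (w⁻¹ * cs.simple i * w) * cs.simple j) :=
    ⟨cs.simple j * w⁻¹, i, by simp [mul_assoc]⟩
  have hne' : cs.simple j * (w⁻¹ * cs.simple i * w) * cs.simple j ≠ cs.simple j := by
    intro h1
    apply hne
    have h2 : cs.simple j * (w⁻¹ * cs.simple i * w) = 1 := mul_eq_right.mp h1
    rw [← cs.inv_simple j]
    exact (inv_eq_of_mul_eq_one_right h2).symm
  have e1 := reflPar_ne_zero_iff cs (w := w) hr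
  have e2 := reflPar_ne_zero_iff cs (w := w * cs.simple j) hr'
  rw [reflPar_mul, reflPar_simple, if_neg hne', zero_add] at e2
  have h3 : cs.simple j * (cs.simple j * (w⁻¹ * cs.simple i * w) * cs.simple j) *
      (cs.simple j)⁻¹ = w⁻¹ * cs.simple i * w := by
    simp [mul_assoc, ← mul_assoc (cs.simple j) (cs.simple j)]
  rw [h3, e1] at e2
  have h4 : w * (w⁻¹ * cs.simple i * w) = cs.simple i * w := by group
  have h5 : w * cs.simple j * (cs.simple j * (w⁻¹ * cs.simple i * w) * cs.simple j) =
      cs.simple i * (w * cs.simple j) := by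
    simp [mul_assoc, ← mul_assoc (cs.simple j) (cs.simple j)]
  rw [h4, h5] at e2
  exact e2.symm

theorem isRightDescent_simple_mul_iff (i j : S) (w : W) (h : cs.simple i * w ≠ w * cs.simple j) :
    cs.IsRightDescent (cs.simple i * w) j ↔ cs.IsRightDescent w j := by
  have h1 := isLeftDescent_mul_simple_iff cs j i w⁻¹ (by
    intro h2
    apply h
    have := congrArg (fun x => x⁻¹) h2
    simpa using this.symm)
  rw [← cs.isRightDescent_inv_iff, ← cs.isRightDescent_inv_iff] at h1
  simpa using h1

/-- Left multiplication by `T_s` on the free module over `W`. -/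
noncomputable def leftOp (s : S) : Module.End QU (W →₀ QU) :=
  open Classical in
  Finsupp.linearCombination QU fun w =>
    if cs.IsLeftDescent w s then
      qu ^ 2 • Finsupp.single (cs.simple s * w) 1 + (qu ^ 2 - 1) • Finsupp.single w 1
    else Finsupp.single (cs.simple s * w) 1

/-- Right multiplication by `T_s` on the free module over `W`. -/
noncomputable def rightOp (s : S) : Module.End QU (W →₀ QU) :=
  open Classical in
  Finsupp.linearCombination QU fun w =>
    if cs.IsRightDescent w s then
      qu ^ 2 • Finsupp.single (w * cs.simple s) 1 + (qu ^ 2 - 1) • Finsupp.single w 1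
    else Finsupp.single (w * cs.simple s) 1

open Classical in
theorem leftOp_single (s : S) (w : W) : leftOp cs s (Finsupp.single w 1) =
    if cs.IsLeftDescent w s then
      qu ^ 2 • Finsupp.single (cs.simple s * w) 1 + (qu ^ 2 - 1) • Finsupp.single w 1
    else Finsupp.single (cs.simple s * w) 1 := by
  rw [leftOp, Finsupp.linearCombination_single, one_smul]

open Classical in
theorem rightOp_single (s : S) (w : W) : rightOp cs s (Finsupp.single w 1) =
    if cs.IsRightDescent w s then
      qu ^ 2 • Finsupp.single (w * cs.simple s) 1 + (qu ^ 2 - 1) • Finsupp.single w 1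
    else Finsupp.single (w * cs.simple s) 1 := by
  rw [rightOp, Finsupp.linearCombination_single, one_smul]

theorem leftOp_eq_rightOp (i j : S) (w : W) (h : cs.simple i * w = w * cs.simple j) :
    leftOp cs i (Finsupp.single w 1) = rightOp cs j (Finsupp.single w 1) := by
  classical
  rw [leftOp_single, rightOp_single, h]
  have : cs.IsLeftDescent w i ↔ cs.IsRightDescent w j := by
    rw [CoxeterSystem.IsLeftDescent, CoxeterSystem.IsRightDescent, h]
  simp only [this]

theorem leftOp_rightOp_comm (i j : S) : Commute (leftOp cs i) (rightOp cs j) := by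
  classical
  refine Finsupp.lhom_ext' fun w => LinearMap.ext_ring ?_
  change leftOp cs i (rightOp cs j (Finsupp.single w 1)) =
    rightOp cs j (leftOp cs i (Finsupp.single w 1))
  by_cases h : cs.simple i * w = w * cs.simple j
  · have h' : cs.simple i * (cs.simple i * w) = (cs.simple i * w) * cs.simple j := by
      rw [cs.simple_mul_simple_cancel_left, h, cs.simple_mul_simple_cancel_right]
    rw [← leftOp_eq_rightOp cs i j w h]
    have h1 := leftOp_eq_rightOp cs i j w h
    have h2 := leftOp_eq_rightOp cs i j _ h'
    rw [leftOp_single cs i w]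
    split_ifs
    · simp only [map_add, map_smul, h1, h2]
    · exact h2
  · have e1 := isLeftDescent_mul_simple_iff cs i j w h
    have e2 := isRightDescent_simple_mul_iff cs i j w h
    rw [leftOp_single, rightOp_single]
    by_cases hi : cs.IsLeftDescent w i <;> by_cases hj : cs.IsRightDescent w j <;>
      simp only [hi, hj, if_true, if_false, map_add, map_smul, leftOp_single, rightOp_single,
        e1, e2, mul_assoc, smul_add, smul_smul, mul_comm (qu ^ 2 - 1) (qu ^ 2)]
    abel

/-- The product of the operators `leftOp` along a word. -/
noncomputable def leftWord (ω : List S) : Module.End QU (W →₀ QU) := (ω.map (leftOp cs)).prod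

theorem leftWord_commute (ω : List S) (j : S) : Commute (leftWord cs ω) (rightOp cs j) := by
  induction ω with
  | nil => exact Commute.one_left _
  | cons i ω ih =>
    rw [leftWord, List.map_cons, List.prod_cons]
    exact (leftOp_rightOp_comm cs i j).mul_left ih

theorem leftWord_apply_one (ω : List S) (hω : cs.IsReduced ω) :
    leftWord cs ω (Finsupp.single 1 1) = Finsupp.single (cs.wordProd ω) 1 := by
  classical
  induction ω with
  | nil => simp [leftWord]
  | cons i ω ih =>
    have h1 : cs.IsReduced ω := by simpa using hω.drop 1
    have h2 : ¬ cs.IsLeftDescent (cs.wordProd ω) i := by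
      have h3 := hω.eq
      rw [cs.wordProd_cons, List.length_cons] at h3
      rw [CoxeterSystem.IsLeftDescent, h1.eq, h3]
      omega
    have h4 := ih h1
    rw [leftWord] at h4 ⊢
    rw [List.map_cons, List.prod_cons, Module.End.mul_apply, h4, leftOp_single, if_neg h2,
      cs.wordProd_cons]

theorem commutant_ext {f g : Module.End QU (W →₀ QU)} (hf : ∀ j, Commute f (rightOp cs j))
    (hg : ∀ j, Commute g (rightOp cs j))
    (h : f (Finsupp.single 1 1) = g (Finsupp.single 1 1)) : f = g := by
  classical
  have key : ∀ w : W, f (Finsupp.single w⁻¹ 1) = g (Finsupp.single w⁻¹ 1) := by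
    intro w
    induction w using coxeter_reduced_induction cs with
    | one => simpa using h
    | step s w hs ih =>
      have h1 : ¬ cs.IsRightDescent w⁻¹ s := by
        rw [cs.isRightDescent_inv_iff, CoxeterSystem.IsLeftDescent]; omega
      have h2 : (Finsupp.single (cs.simple s * w)⁻¹ 1 : W →₀ QU) =
          rightOp cs s (Finsupp.single w⁻¹ 1) := by
        rw [rightOp_single, if_neg h1]; simp
      rw [h2]
      have hf' := LinearMap.congr_fun (hf s).eq (Finsupp.single w⁻¹ 1)
      have hg' := LinearMap.congr_fun (hg s).eq (Finsupp.single w⁻¹ 1)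
      simp only [Module.End.mul_apply] at hf' hg'
      rw [hf', hg', ih]
  refine Finsupp.lhom_ext' fun w => LinearMap.ext_ring ?_
  simpa using key w⁻¹

/-- Left multiplication by `T_w` on the free module over `W`. -/
noncomputable def leftMul (w : W) : Module.End QU (W →₀ QU) :=
  leftWord cs (cs.exists_isReduced w).choose

theorem leftMul_commute (w : W) (j : S) : Commute (leftMul cs w) (rightOp cs j) :=
  leftWord_commute cs _ j

theorem leftMul_apply_one (w : W) : leftMul cs w (Finsupp.single 1 1) = Finsupp.single w 1 := by
  have h := (cs.exists_isReduced w).choose_spec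
  rw [leftMul, leftWord_apply_one cs _ h.1, ← h.2]

theorem leftMul_simple (s : S) : leftMul cs (cs.simple s) = leftOp cs s := by
  classical
  refine commutant_ext cs (leftMul_commute cs _) (leftOp_rightOp_comm cs s) ?_
  rw [leftMul_apply_one, leftOp_single, if_neg (cs.not_isLeftDescent_one s), mul_one]

/-- The left regular representation of `H`, in the coordinates `T_w`. -/
noncomputable def heckeRegular : HeckeAlgebra cs →ₐ[QU] Module.End QU (W →₀ QU) :=
  RingQuot.liftAlgHom QU ⟨FreeAlgebra.lift QU (leftMul cs), by
    classical
    rintro _ _ (_ | ⟨s, w, h⟩ | ⟨s, w, h⟩)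
    · rw [FreeAlgebra.lift_ι_apply, map_one]
      refine commutant_ext cs (leftMul_commute cs _) (fun j => Commute.one_left _) ?_
      rw [leftMul_apply_one]; rfl
    · rw [map_mul, FreeAlgebra.lift_ι_apply, FreeAlgebra.lift_ι_apply, FreeAlgebra.lift_ι_apply]
      refine commutant_ext cs
        (fun j => (leftMul_commute cs _ j).mul_left (leftMul_commute cs _ j))
        (leftMul_commute cs _) ?_
      rw [Module.End.mul_apply, leftMul_apply_one, leftMul_apply_one, leftMul_simple,
        leftOp_single, if_neg]
      rw [CoxeterSystem.IsLeftDescent]; omega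
    · rw [map_mul, map_add, map_smul, map_smul, FreeAlgebra.lift_ι_apply,
        FreeAlgebra.lift_ι_apply, FreeAlgebra.lift_ι_apply]
      refine commutant_ext cs
        (fun j => (leftMul_commute cs _ j).mul_left (leftMul_commute cs _ j))
        (fun j => ((leftMul_commute cs _ j).smul_left _).add_left
          ((leftMul_commute cs _ j).smul_left _)) ?_
      rw [Module.End.mul_apply, LinearMap.add_apply, LinearMap.smul_apply, LinearMap.smul_apply,
        leftMul_apply_one, leftMul_apply_one, leftMul_simple, leftOp_single, if_pos]
      exact h⟩

theorem heckeRegular_apply_one (w : W) :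
    heckeRegular cs (heckeT cs w) (Finsupp.single 1 1) = Finsupp.single w 1 := by
  rw [heckeRegular, heckeT, RingQuot.liftAlgHom_mkAlgHom_apply, FreeAlgebra.lift_ι_apply,
    leftMul_apply_one]

theorem heckeT_linearIndependent : LinearIndependent QU (heckeT cs) := by
  let ev : HeckeAlgebra cs →ₗ[QU] (W →₀ QU) :=
    (LinearMap.applyₗ (Finsupp.single (1 : W) (1 : QU))).comp (heckeRegular cs).toLinearMap
  refine LinearIndependent.of_comp ev ?_
  have h : ev ∘ heckeT cs = fun w : W => Finsupp.single w (1 : QU) :=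
    funext fun w => heckeRegular_apply_one cs w
  rw [h]
  exact Finsupp.linearIndependent_single_one QU W

theorem heckeT_span : ⊤ ≤ Submodule.span QU (Set.range (heckeT cs)) := by
  set N := Submodule.span QU (Set.range (heckeT cs)) with hN
  have hT : ∀ w, heckeT cs w ∈ N := fun w => Submodule.subset_span ⟨w, rfl⟩
  have hs : ∀ s, ∀ x ∈ N, heckeT cs (cs.simple s) * x ∈ N := by
    intro s x hx
    induction hx using Submodule.span_induction with
    | mem x hx =>
      obtain ⟨w, rfl⟩ := hx
      rcases lt_or_gt_of_ne (cs.length_simple_mul_ne w s) with h | h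
      · rw [heckeT_mul_of_gt cs s w h]
        exact N.add_mem (N.smul_mem _ (hT _)) (N.smul_mem _ (hT _))
      · rw [heckeT_mul_of_lt cs s w h]; exact hT _
    | zero => rw [mul_zero]; exact N.zero_mem
    | add x y _ _ hx hy => rw [mul_add]; exact N.add_mem hx hy
    | smul a x _ hx => rw [mul_smul_comm]; exact N.smul_mem _ hx
  have hw : ∀ w, ∀ x ∈ N, heckeT cs w * x ∈ N := by
    intro w
    induction w using coxeter_reduced_induction cs with
    | one => intro x hx; rwa [heckeT_one, one_mul]
    | step s w h ih =>
      intro x hx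
      rw [← heckeT_mul_of_lt cs s w h, mul_assoc]
      exact hs s _ (ih x hx)
  have hall : ∀ y : FreeAlgebra QU W, ∀ x ∈ N, RingQuot.mkAlgHom QU (HeckeRel cs) y * x ∈ N := by
    intro y
    induction y using FreeAlgebra.induction with
    | grade0 r => intro x hx; rw [AlgHom.commutes, ← Algebra.smul_def]; exact N.smul_mem _ hx
    | grade1 w => exact hw w
    | mul a b ha hb => intro x hx; rw [map_mul, mul_assoc]; exact ha _ (hb x hx)
    | add a b ha hb => intro x hx; rw [map_add, add_mul]; exact N.add_mem (ha x hx) (hb x hx)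
  intro x _
  obtain ⟨y, rfl⟩ := RingQuot.mkAlgHom_surjective QU (HeckeRel cs) x
  have h := hall y (heckeT cs 1) (hT 1)
  rwa [heckeT_one, mul_one] at h

/-- The basis `T_w`, `w ∈ W`, of the Hecke algebra. -/
noncomputable def heckeBasis : Module.Basis W QU (HeckeAlgebra cs) :=
  Module.Basis.mk (heckeT_linearIndependent cs) (heckeT_span cs)

end Hecke

/-! ### Labeled digraphs -/

/-- The two types of edges. -/
inductive EdgeKind
  | solid
  | dashed

/-- A directed edge from `src` to `tgt`, labeled by an element of `S`, either solid or dashed. -/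
structure LabeledEdge (S V : Type*) where
  src : V
  tgt : V
  label : S
  kind : EdgeKind

/-- The edge in the opposite direction, of the same type and with the same label. -/
def LabeledEdge.reverse {S V : Type*} (e : LabeledEdge S V) : LabeledEdge S V :=
  ⟨e.tgt, e.src, e.label, e.kind⟩

/-- An `S`-labeled digraph with vertex set `V`: a directed multigraph without loops, each edge
solid or dashed and labeled by an element of `S`, such that for all `s`, every vertex occurs in
exactly one edge labeled `s`. (By the last condition no two edges can have the same ends,
direction, label and type, so a set of edges suffices.) -/
structure LabeledDigraph (S V : Type*) where
  edges : Set (LabeledEdge S V)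
  loopless : ∀ e ∈ edges, e.src ≠ e.tgt
  existsUnique_edge : ∀ (s : S) (α : V),
    ∃! e, e ∈ edges ∧ e.label = s ∧ (e.src = α ∨ e.tgt = α)

namespace LabeledDigraph

variable {S V : Type*} (Γ : LabeledDigraph S V)

/-- `Γ_rev`: all edges reversed, types and labels kept. -/
def rev : LabeledDigraph S V where
  edges := {e | e.reverse ∈ Γ.edges}
  loopless e he := (Γ.loopless _ he).symm
  existsUnique_edge s α := by
    obtain ⟨e, ⟨h1, h2, h3⟩, h4⟩ := Γ.existsUnique_edge s α
    refine ⟨e.reverse, ⟨h1, h2, h3.symm⟩, fun f hf => ?_⟩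
    have h := h4 f.reverse ⟨hf.1, hf.2.1, hf.2.2.symm⟩
    rw [← h]; rfl

/-- There is an edge from `α` to `β`, of any label and type. -/
def Arc (α β : V) : Prop := ∃ e ∈ Γ.edges, e.src = α ∧ e.tgt = β

/-- There is no nonempty directed circuit. -/
def Acyclic : Prop := ∀ α, ¬ Relation.TransGen Γ.Arc α α

/-- The unique edge labeled `s` in which the vertex `α` occurs. -/
noncomputable def edgeAt (s : S) (α : V) : LabeledEdge S V :=
  (Γ.existsUnique_edge s α).choose

theorem edgeAt_spec (s : S) (α : V) : Γ.edgeAt s α ∈ Γ.edges ∧ (Γ.edgeAt s α).label = s ∧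
    ((Γ.edgeAt s α).src = α ∨ (Γ.edgeAt s α).tgt = α) :=
  (Γ.existsUnique_edge s α).choose_spec.1

theorem edgeAt_eq {e : LabeledEdge S V} (he : e ∈ Γ.edges) {α : V} (hα : e.src = α ∨ e.tgt = α) :
    Γ.edgeAt e.label α = e :=
  ((Γ.existsUnique_edge e.label α).choose_spec.2 e ⟨he, rfl, hα⟩).symm

/-- The vector `τ_s(α)` in the vector space `M(Γ) = V →₀ ℚ(u)` with basis `V`. -/
noncomputable def tauVertex (s : S) (α : V) : V →₀ QU :=
  open Classical in
  let e := Γ.edgeAt s α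
  match e.kind with
  | .solid =>
    if e.src = α then Finsupp.single e.tgt 1
    else Finsupp.single α (qu ^ 2 - 1) + Finsupp.single e.src (qu ^ 2)
  | .dashed =>
    if e.src = α then Finsupp.single α qu + Finsupp.single e.tgt (qu + 1)
    else Finsupp.single α (qu ^ 2 - qu - 1) + Finsupp.single e.src (qu ^ 2 - qu)

/-- The linear operator `τ_s` on `M(Γ)`. -/
noncomputable def tau (s : S) : Module.End QU (V →₀ QU) :=
  Finsupp.linearCombination QU (Γ.tauVertex s)

theorem tau_single (s : S) (α : V) : Γ.tau s (Finsupp.single α 1) = Γ.tauVertex s α := by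
  rw [tau, Finsupp.linearCombination_single, one_smul]

/-- The four cases of the definition of `τ_s`, in terms of the edges. -/
theorem tau_src_solid {α β : V} {s : S} (h : ⟨α, β, s, .solid⟩ ∈ Γ.edges) :
    Γ.tau s (Finsupp.single α 1) = Finsupp.single β 1 := by
  have he := Γ.edgeAt_eq h (Or.inl rfl)
  simp only at he
  simp [tau_single, tauVertex, he]

theorem tau_tgt_solid {α β : V} {s : S} (h : ⟨β, α, s, .solid⟩ ∈ Γ.edges) :
    Γ.tau s (Finsupp.single α 1) =
      Finsupp.single α (qu ^ 2 - 1) + Finsupp.single β (qu ^ 2) := by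
  have he := Γ.edgeAt_eq h (Or.inr rfl)
  have hne : β ≠ α := Γ.loopless _ h
  simp only at he
  simp [tau_single, tauVertex, he, hne]

theorem tau_src_dashed {α β : V} {s : S} (h : ⟨α, β, s, .dashed⟩ ∈ Γ.edges) :
    Γ.tau s (Finsupp.single α 1) = Finsupp.single α qu + Finsupp.single β (qu + 1) := by
  have he := Γ.edgeAt_eq h (Or.inl rfl)
  simp only at he
  simp [tau_single, tauVertex, he]

theorem tau_tgt_dashed {α β : V} {s : S} (h : ⟨β, α, s, .dashed⟩ ∈ Γ.edges) :
    Γ.tau s (Finsupp.single α 1) =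
      Finsupp.single α (qu ^ 2 - qu - 1) + Finsupp.single β (qu ^ 2 - qu) := by
  have he := Γ.edgeAt_eq h (Or.inr rfl)
  have hne : β ≠ α := Γ.loopless _ h
  simp only at he
  simp [tau_single, tauVertex, he, hne]

variable {W : Type*} [Group W] {M : CoxeterMatrix S} (cs : CoxeterSystem M W)

/-- `Γ` is a `W`-digraph: `T_s ↦ τ_s` extends to a representation of `H` on `M(Γ)`. -/
def IsWDigraph : Prop :=
  ∃ ρ : HeckeAlgebra cs →ₐ[QU] Module.End QU (V →₀ QU),
    ∀ s, ρ (heckeT cs (cs.simple s)) = Γ.tau s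

variable {Γ cs}

/-- The representation of `H` on `M(Γ)` afforded by a `W`-digraph `Γ`. -/
noncomputable def IsWDigraph.rep (h : Γ.IsWDigraph cs) :
    HeckeAlgebra cs →ₐ[QU] Module.End QU (V →₀ QU) := h.choose

theorem IsWDigraph.rep_simple (h : Γ.IsWDigraph cs) (s : S) :
    h.rep (heckeT cs (cs.simple s)) = Γ.tau s := h.choose_spec s

/-- The representation is the only one extending `T_s ↦ τ_s`. -/
theorem IsWDigraph.rep_unique (h : Γ.IsWDigraph cs)
    (ρ : HeckeAlgebra cs →ₐ[QU] Module.End QU (V →₀ QU))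
    (hρ : ∀ s, ρ (heckeT cs (cs.simple s)) = Γ.tau s) : ρ = h.rep :=
  heckeAlgebra_algHom_ext cs fun s => by rw [hρ, h.rep_simple]

/-- The character `χ_Γ` of `H` afforded by `M(Γ)`, for a `W`-digraph with finitely many
vertices. -/
noncomputable def IsWDigraph.character [Finite V] (h : Γ.IsWDigraph cs) (x : HeckeAlgebra cs) :
    QU :=
  LinearMap.trace QU (V →₀ QU) (h.rep x)

end LabeledDigraph

/-! ### Inverses and products of the `T_w` -/

section Hecke

variable {S W : Type*} [Group W] {M : CoxeterMatrix S} (cs : CoxeterSystem M W)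

/-! Each `τ_s` is block diagonal, with one 2×2 block per `s`-edge, and reversing the edge changes
the block in two equivalent ways.

Entrywise, the matrix of `τ_s` for `Γ.rev` is `σ` applied to the matrix of `τ_s⁻¹`. The assignment
`T_w ↦ T_{w⁻¹}⁻¹` is multiplicative along reduced products and satisfies the quadratic relation with
`u²` replaced by `u⁻²`; applying `σ` restores `u²`. So `Γ.rev` affords a representation, and (i)
follows by taking traces.

For (ii), suppose the vertices carry signs that differ at the two ends of every edge, and let `D` be
the diagonal matrix of signs. Then `τ_s` for `Γ.rev` has matrix `D (-u² τ_s⁻¹)ᵀ D`. Transposition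
and `T_w ↦ T_w⁻¹` both reverse products, so this propagates to all `T_w`, and the trace removes both
`D` and the transpose.

The signs come from reduction at `u = 0`, where `-τ_s` fixes the target of an `s`-edge and sends its
source to minus its target. It thus moves signed vertices along the relation "follow an edge and
change sign" (`SignedArc`). An element with reduced expressions ending in `s` and in `t` makes two
such steps from one vertex meet again (`signedArc_locally_confluent`). Acyclicity and finiteness
give termination, so Newman's lemma yields unique normal forms; the sign of the normal form of `(α,
1)` is the required sign of `α`. -/

theorem heckeT_mul_simple_of_lt (s : S) (w : W) (h : cs.length w < cs.length (w * cs.simple s)) :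
    heckeT cs w * heckeT cs (cs.simple s) = heckeT cs (w * cs.simple s) := by
  induction w using coxeter_reduced_induction cs with
  | one => rw [heckeT_one, one_mul, one_mul]
  | step t w hw ih =>
    have h1 := cs.length_simple_mul w t
    have h2 := cs.length_mul_simple w s
    have h3 := cs.length_mul_simple (cs.simple t * w) s
    have h4 := cs.length_simple_mul (w * cs.simple s) t
    rw [← mul_assoc] at h4
    -- Here `ℓ(tws) = ℓ(w) + 2`, which forces `ℓ(ws) = ℓ(w) + 1`; both length conditions follow.
    rw [← heckeT_mul_of_lt cs t w hw, mul_assoc, ih (by omega), heckeT_mul_of_lt, mul_assoc]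
    rw [← mul_assoc]
    omega

theorem heckeTInv_eq_of_mul_eq_one {w : W} {x : HeckeAlgebra cs} (h : heckeT cs w * x = 1) :
    x = heckeTInv cs w :=
  (left_inv_eq_right_inv (heckeTInv_mul_heckeT cs w) h).symm

theorem heckeTInv_one : heckeTInv cs 1 = 1 :=
  (heckeTInv_eq_of_mul_eq_one cs (by rw [heckeT_one, one_mul])).symm

theorem heckeTInv_simple (s : S) :
    heckeTInv cs (cs.simple s) =
      (qu ^ 2)⁻¹ • (heckeT cs (cs.simple s) - (qu ^ 2 - 1) • (1 : HeckeAlgebra cs)) := by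
  symm
  apply heckeTInv_eq_of_mul_eq_one
  rw [mul_smul_comm, mul_sub, heckeT_simple_mul_self, mul_smul_comm, mul_one,
    add_sub_cancel_right, smul_smul, inv_mul_cancel₀ (pow_ne_zero 2 qu_ne_zero), one_smul]

/-- This is the quadratic relation with `u²` replaced by `u⁻²`, the reason `σ` enters part (i). -/
theorem heckeTInv_simple_mul_self (s : S) :
    heckeTInv cs (cs.simple s) * heckeTInv cs (cs.simple s) =
      (qu ^ 2)⁻¹ • (1 : HeckeAlgebra cs) +
        ((qu ^ 2)⁻¹ - 1) • heckeTInv cs (cs.simple s) := by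
  have hu : (qu ^ 2)⁻¹ * qu ^ 2 = 1 := inv_mul_cancel₀ (pow_ne_zero 2 qu_ne_zero)
  conv_lhs => enter [1]; rw [heckeTInv_simple]
  rw [smul_mul_assoc, sub_mul, heckeT_mul_heckeTInv, smul_mul_assoc, one_mul, smul_sub, smul_smul,
    mul_sub, hu, mul_one, sub_eq_add_neg, ← neg_smul, neg_sub]

theorem heckeTInv_simple_mul_of_lt (s : S) (w : W)
    (h : cs.length w < cs.length (cs.simple s * w)) :
    heckeTInv cs (cs.simple s * w) = heckeTInv cs w * heckeTInv cs (cs.simple s) := by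
  symm
  apply heckeTInv_eq_of_mul_eq_one
  rw [← heckeT_mul_of_lt cs s w h, mul_assoc, ← mul_assoc (heckeT cs w), heckeT_mul_heckeTInv,
    one_mul, heckeT_mul_heckeTInv]

theorem heckeTInv_mul_simple_of_lt (s : S) (w : W)
    (h : cs.length w < cs.length (w * cs.simple s)) :
    heckeTInv cs (w * cs.simple s) = heckeTInv cs (cs.simple s) * heckeTInv cs w := by
  symm
  apply heckeTInv_eq_of_mul_eq_one
  rw [← heckeT_mul_simple_of_lt cs s w h, mul_assoc, ← mul_assoc (heckeT cs (cs.simple s)),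
    heckeT_mul_heckeTInv, one_mul, heckeT_mul_heckeTInv]

/-- The map `T_w ↦ T_{w⁻¹}⁻¹` (the bar involution) preserves the order of factors. -/
theorem heckeTInv_inv_simple_mul_of_lt (s : S) (w : W)
    (h : cs.length w < cs.length (cs.simple s * w)) :
    heckeTInv cs (cs.simple s * w)⁻¹ = heckeTInv cs (cs.simple s) * heckeTInv cs w⁻¹ := by
  rw [mul_inv_rev, cs.inv_simple]
  apply heckeTInv_mul_simple_of_lt
  rwa [cs.length_inv, ← cs.length_inv (w⁻¹ * _), mul_inv_rev, inv_inv, cs.inv_simple]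

/-- An assignment of elements of an algebra to the elements of `W` which is multiplicative along
reduced products and satisfies the quadratic relations defines a homomorphism from `H`. -/
noncomputable def heckeLift {A : Type*} [Ring A] [Algebra QU A] (f : W → A) (one : f 1 = 1)
    (mul : ∀ (s : S) (w : W), cs.length w < cs.length (cs.simple s * w) →
      f (cs.simple s * w) = f (cs.simple s) * f w)
    (quadratic : ∀ s, f (cs.simple s) * f (cs.simple s) =
      qu ^ 2 • 1 + (qu ^ 2 - 1) • f (cs.simple s)) : HeckeAlgebra cs →ₐ[QU] A :=
  RingQuot.liftAlgHom QU ⟨FreeAlgebra.lift QU f, fun x y h => by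
    induction h with
    | one => rw [FreeAlgebra.lift_ι_apply, one, map_one]
    | mul_of_lt s w h =>
      simp only [map_mul, FreeAlgebra.lift_ι_apply, mul s w h]
    | mul_of_gt s w h =>
      -- In the descending case `w = s(sw)` is a reduced product, so `f w` factors and the quadratic
      -- relation applies.
      have h1 := mul s (cs.simple s * w) (by rwa [cs.simple_mul_simple_cancel_left])
      rw [cs.simple_mul_simple_cancel_left] at h1
      simp only [map_mul, map_add, map_smul, FreeAlgebra.lift_ι_apply]
      rw [h1, ← mul_assoc, quadratic, add_mul, smul_mul_assoc, one_mul, smul_mul_assoc]⟩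

theorem heckeLift_heckeT {A : Type*} [Ring A] [Algebra QU A] (f : W → A) (one : f 1 = 1)
    (mul : ∀ (s : S) (w : W), cs.length w < cs.length (cs.simple s * w) →
      f (cs.simple s * w) = f (cs.simple s) * f w)
    (quadratic : ∀ s, f (cs.simple s) * f (cs.simple s) =
      qu ^ 2 • 1 + (qu ^ 2 - 1) • f (cs.simple s)) (w : W) :
    heckeLift cs f one mul quadratic (heckeT cs w) = f w := by
  rw [heckeLift, heckeT, RingQuot.liftAlgHom_mkAlgHom_apply, FreeAlgebra.lift_ι_apply]

end Hecke

/-! ### The matrices of the operators `τ_s` -/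

namespace LabeledDigraph

variable {S V : Type*} (Γ : LabeledDigraph S V)

theorem exists_edge (s : S) (α : V) : ∃ β k,
    (⟨α, β, s, k⟩ : LabeledEdge S V) ∈ Γ.edges ∨ (⟨β, α, s, k⟩ : LabeledEdge S V) ∈ Γ.edges := by
  obtain ⟨e, ⟨h1, rfl, h3⟩, -⟩ := Γ.existsUnique_edge s α
  rcases h3 with rfl | rfl
  · exact ⟨e.tgt, e.kind, Or.inl h1⟩
  · exact ⟨e.src, e.kind, Or.inr h1⟩

/-- Block structure of `τ_s`: the ends of an `s`-edge span a block of their own. The transpose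
comparison needs it, since it reads entries from a different column. -/
theorem tauVertex_eq_zero {s : S} {α β γ : V} {k : EdgeKind}
    (h : (⟨α, β, s, k⟩ : LabeledEdge S V) ∈ Γ.edges) (hα : γ ≠ α) (hβ : γ ≠ β) :
    Γ.tauVertex s γ α = 0 ∧ Γ.tauVertex s γ β = 0 := by
  have hA := Γ.edgeAt_eq h (α := α) (Or.inl rfl)
  have hB := Γ.edgeAt_eq h (α := β) (Or.inr rfl)
  simp only at hA hB
  -- The `s`-edge at `γ` cannot touch `α` or `β`, whose only `s`-edge joins them to each other.
  have key : ∀ (δ ε : V) (l : EdgeKind), (⟨δ, ε, s, l⟩ : LabeledEdge S V) ∈ Γ.edges →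
      γ = δ ∨ γ = ε → (α ≠ δ ∧ α ≠ ε) ∧ (β ≠ δ ∧ β ≠ ε) := by
    intro δ ε l he hγ
    have hD := Γ.edgeAt_eq he (α := δ) (Or.inl rfl)
    have hE := Γ.edgeAt_eq he (α := ε) (Or.inr rfl)
    simp only at hD hE
    grind
  obtain ⟨δ, k, h | h⟩ := Γ.exists_edge s γ
  · obtain ⟨⟨h1, h2⟩, h3, h4⟩ := key _ _ _ h (Or.inl rfl)
    cases k
    · simp [← Γ.tau_single, Γ.tau_src_solid h, *]
    · simp [← Γ.tau_single, Γ.tau_src_dashed h, *]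
  · obtain ⟨⟨h1, h2⟩, h3, h4⟩ := key _ _ _ h (Or.inr rfl)
    cases k
    · simp [← Γ.tau_single, Γ.tau_tgt_solid h, *]
    · simp [← Γ.tau_single, Γ.tau_tgt_dashed h, *]

/-- The expression inside `sigma` is an entry of `τ_s⁻¹`, by the quadratic relation. The identity is
checked on the 2×2 block of each type of edge. -/
theorem tauVertex_rev_eq_sigma [DecidableEq V] (s : S) (α β : V) :
    Γ.rev.tauVertex s β α = sigma ((qu ^ 2)⁻¹ * (Γ.tauVertex s β α -
      (qu ^ 2 - 1) * (1 : Matrix V V QU) α β)) := by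
  have hu := qu_ne_zero
  have hone : sigma ((1 : Matrix V V QU) α β) = Finsupp.single β 1 α := by
    rw [Matrix.one_apply, Finsupp.single_apply]
    simp only [eq_comm]
    split_ifs <;> simp
  simp only [map_mul, map_inv₀, map_sub, map_pow, sigma_qu, map_one, hone]
  obtain ⟨γ, k, h | h⟩ := Γ.exists_edge s β
  · have h' : (⟨γ, β, s, k⟩ : LabeledEdge S V) ∈ Γ.rev.edges := h
    have hne := Γ.loopless _ h
    simp only at hne
    cases k
    · rw [← tau_single, ← tau_single, Γ.tau_src_solid h, Γ.rev.tau_tgt_solid h']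
      by_cases h1 : β = α
      · subst h1; simp [hne.symm]; field
      · by_cases h2 : γ = α
        · subst h2; simp [hne]; field
        · simp [h1, h2]
    · rw [← tau_single, ← tau_single, Γ.tau_src_dashed h, Γ.rev.tau_tgt_dashed h']
      by_cases h1 : β = α
      · subst h1; simp [hne.symm, sigma_qu]; field
      · by_cases h2 : γ = α
        · subst h2; simp [hne, sigma_qu]; field
        · simp [h1, h2]
  · have h' : (⟨β, γ, s, k⟩ : LabeledEdge S V) ∈ Γ.rev.edges := h
    have hne := (Γ.loopless _ h).symm
    simp only at hne
    cases k
    · rw [← tau_single, ← tau_single, Γ.tau_tgt_solid h, Γ.rev.tau_src_solid h']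
      by_cases h1 : β = α
      · subst h1; simp [hne.symm, sigma_qu]
      · by_cases h2 : γ = α
        · subst h2; simp [hne, sigma_qu]; field
        · simp [h1, h2]
    · rw [← tau_single, ← tau_single, Γ.tau_tgt_dashed h, Γ.rev.tau_src_dashed h']
      by_cases h1 : β = α
      · subst h1; simp [hne.symm, sigma_qu]; field
      · by_cases h2 : γ = α
        · subst h2; simp [hne, sigma_qu]; field
        · simp [h1, h2]

/-- Since `(u² - 1) - τ_s = -u² τ_s⁻¹`, transposing a block gives the reversed block up to the sign
of its off-diagonal entries. The opposite signs at the two ends correct exactly those, and `ε² = 1`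
leaves the diagonal alone. -/
theorem tauVertex_rev_eq_transpose [DecidableEq V] (ε : V → ℤˣ)
    (hε : ∀ e ∈ Γ.edges, ε e.src = -ε e.tgt) (s : S) (α β : V) :
    Γ.rev.tauVertex s β α = ((ε α : ℤ) : QU) * ((qu ^ 2 - 1) * (1 : Matrix V V QU) α β -
      Γ.tauVertex s α β) * ((ε β : ℤ) : QU) := by
  have hone : (1 : Matrix V V QU) α β = Finsupp.single β 1 α := by
    rw [Matrix.one_apply, Finsupp.single_apply]
    simp only [eq_comm]
  have hsq : ∀ γ, ((ε γ : ℤ) : QU) * ((ε γ : ℤ) : QU) = 1 := by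
    intro γ; rw [← Int.cast_mul, ← Units.val_mul, Int.units_mul_self]; simp
  rw [hone]
  obtain ⟨γ, k, h | h⟩ := Γ.exists_edge s β
  · have h' : (⟨γ, β, s, k⟩ : LabeledEdge S V) ∈ Γ.rev.edges := h
    have hne : β ≠ γ := Γ.loopless _ h
    have hs := hε _ h
    simp only at hs
    by_cases h1 : β = α
    · subst h1
      cases k
      · rw [← tau_single, ← tau_single, Γ.tau_src_solid h, Γ.rev.tau_tgt_solid h']
        simp [hne]
        linear_combination (1 - qu ^ 2) * hsq β
      · rw [← tau_single, ← tau_single, Γ.tau_src_dashed h, Γ.rev.tau_tgt_dashed h']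
        simp [hne]
        linear_combination (1 + qu - qu ^ 2) * hsq β
    by_cases h2 : γ = α
    · subst h2
      cases k
      · rw [← tau_single, ← tau_single, Γ.tau_tgt_solid h, Γ.rev.tau_tgt_solid h']
        simp [hne, hne.symm, hs]
        linear_combination (- qu ^ 2) * hsq γ
      · rw [← tau_single, ← tau_single, Γ.tau_tgt_dashed h, Γ.rev.tau_tgt_dashed h']
        simp [hne, hne.symm, hs]
        linear_combination (qu - qu ^ 2) * hsq γ
    · rw [(Γ.tauVertex_eq_zero h (Ne.symm h1) (Ne.symm h2)).1]
      cases k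
      · rw [← tau_single, Γ.rev.tau_tgt_solid h']
        simp [h1, h2]
      · rw [← tau_single, Γ.rev.tau_tgt_dashed h']
        simp [h1, h2]
  · have h' : (⟨β, γ, s, k⟩ : LabeledEdge S V) ∈ Γ.rev.edges := h
    have hne : β ≠ γ := (Γ.loopless _ h).symm
    have hs := hε _ h
    simp only at hs
    by_cases h1 : β = α
    · subst h1
      cases k
      · rw [← tau_single, ← tau_single, Γ.tau_tgt_solid h, Γ.rev.tau_src_solid h']
        simp [hne]
      · rw [← tau_single, ← tau_single, Γ.tau_tgt_dashed h, Γ.rev.tau_src_dashed h']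
        simp [hne]
        linear_combination (- qu) * hsq β
    by_cases h2 : γ = α
    · subst h2
      cases k
      · rw [← tau_single, ← tau_single, Γ.tau_src_solid h, Γ.rev.tau_src_solid h']
        simp [hne.symm, hs]
        linear_combination (- 1 : QU) * hsq β
      · rw [← tau_single, ← tau_single, Γ.tau_src_dashed h, Γ.rev.tau_src_dashed h']
        simp [hne, hne.symm, hs]
        linear_combination (- qu - 1) * hsq β
    · rw [(Γ.tauVertex_eq_zero h (Ne.symm h2) (Ne.symm h1)).2]
      cases k
      · rw [← tau_single, Γ.rev.tau_src_solid h']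
        simp [h1, h2]
      · rw [← tau_single, Γ.rev.tau_src_dashed h']
        simp [h1, h2]

/-! ### The representation on `M(Γ_rev)` and its character -/

section Matrix

variable [Fintype V] [DecidableEq V]

/-- The matrix of an operator on `M(Γ)` with respect to the basis of vertices. -/
noncomputable def vertexMatrix : Module.End QU (V →₀ QU) ≃ₐ[QU] Matrix V V QU :=
  LinearMap.toMatrixAlgEquiv Finsupp.basisSingleOne

theorem vertexMatrix_tau (s : S) (α β : V) :
    vertexMatrix (Γ.tau s) α β = Γ.tauVertex s β α := by
  rw [vertexMatrix, LinearMap.toMatrixAlgEquiv_apply, Finsupp.coe_basisSingleOne, tau_single]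
  rfl

theorem trace_vertexMatrix (f : Module.End QU (V →₀ QU)) :
    (vertexMatrix f).trace = LinearMap.trace QU (V →₀ QU) f :=
  (LinearMap.trace_eq_matrix_trace QU Finsupp.basisSingleOne f).symm

variable {Γ} {W : Type*} [Group W] {M : CoxeterMatrix S} {cs : CoxeterSystem M W}

theorem vertexMatrix_tau_rev_eq_sigma (hΓ : Γ.IsWDigraph cs) (s : S) :
    vertexMatrix (Γ.rev.tau s) =
      sigma.mapMatrix (vertexMatrix (hΓ.rep (heckeTInv cs (cs.simple s)))) := by
  ext α β
  rw [vertexMatrix_tau, tauVertex_rev_eq_sigma, heckeTInv_simple,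
    map_smul hΓ.rep, map_smul vertexMatrix, map_sub hΓ.rep, map_sub vertexMatrix, hΓ.rep_simple,
    map_smul hΓ.rep, map_smul vertexMatrix, map_one hΓ.rep, map_one vertexMatrix]
  simp only [RingEquiv.mapMatrix_apply, Matrix.map_apply, Matrix.smul_apply, Matrix.sub_apply,
    vertexMatrix_tau, smul_eq_mul]

theorem vertexMatrix_tau_rev_eq_transpose (hΓ : Γ.IsWDigraph cs) (ε : V → ℤˣ)
    (hε : ∀ e ∈ Γ.edges, ε e.src = -ε e.tgt) (s : S) :
    vertexMatrix (Γ.rev.tau s) = Matrix.diagonal (fun α => ((ε α : ℤ) : QU)) *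
      (-qu ^ 2 • vertexMatrix (hΓ.rep (heckeTInv cs (cs.simple s)))).transpose *
      Matrix.diagonal (fun α => ((ε α : ℤ) : QU)) := by
  ext α β
  have hu : (qu ^ 2) * (qu ^ 2)⁻¹ = 1 := mul_inv_cancel₀ (pow_ne_zero 2 qu_ne_zero)
  rw [vertexMatrix_tau, tauVertex_rev_eq_transpose Γ ε hε, heckeTInv_simple, map_smul, map_smul,
    map_sub, map_sub, hΓ.rep_simple, map_smul, map_smul, map_one, map_one, smul_smul, neg_mul, hu,
    neg_smul, one_smul, neg_sub]
  simp [vertexMatrix_tau, Matrix.one_apply]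

/-- The representation of `H` on `M(Γ_rev)`, obtained from that on `M(Γ)` by composing with the
bar involution and applying `σ` to matrix entries. -/
noncomputable def revRep (hΓ : Γ.IsWDigraph cs) : HeckeAlgebra cs →ₐ[QU] Matrix V V QU :=
  heckeLift cs (fun w => sigma.mapMatrix (vertexMatrix (hΓ.rep (heckeTInv cs w⁻¹))))
    (by simp only [inv_one, heckeTInv_one, map_one])
    (fun s w h => by
      simp only [heckeTInv_inv_simple_mul_of_lt cs s w h, map_mul, cs.inv_simple])
    (fun s => by
      have hs : ∀ (c : QU) (A : Matrix V V QU),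
          sigma.mapMatrix (c • A) = sigma c • sigma.mapMatrix A := by
        intro c A; ext; simp
      -- `σ` inverts `u²`, which turns the relation for `T_s⁻¹` back into the one for `T_s`.
      have h1 : sigma (qu ^ 2)⁻¹ = qu ^ 2 := by simp [sigma_qu, div_pow]
      have h2 : sigma ((qu ^ 2)⁻¹ - 1) = qu ^ 2 - 1 := by rw [map_sub, h1, map_one]
      rw [cs.inv_simple, ← map_mul, ← map_mul, ← map_mul, heckeTInv_simple_mul_self]
      simp only [map_add, map_smul, hs, map_one, h1, h2])

theorem isWDigraph_rev (hΓ : Γ.IsWDigraph cs) : Γ.rev.IsWDigraph cs :=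
  ⟨(vertexMatrix (V := V)).symm.toAlgHom.comp (revRep hΓ), fun s => by
    rw [AlgHom.comp_apply, revRep, heckeLift_heckeT, cs.inv_simple,
      ← vertexMatrix_tau_rev_eq_sigma]
    exact vertexMatrix.symm_apply_apply _⟩

theorem vertexMatrix_rep_rev (hΓ : Γ.IsWDigraph cs) (hrev : Γ.rev.IsWDigraph cs) (w : W) :
    vertexMatrix (hrev.rep (heckeT cs w)) =
      sigma.mapMatrix (vertexMatrix (hΓ.rep (heckeTInv cs w⁻¹))) := by
  induction w using coxeter_reduced_induction cs with
  | one => simp only [heckeT_one, inv_one, heckeTInv_one, map_one]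
  | step s w h ih =>
    rw [← heckeT_mul_of_lt cs s w h, map_mul, map_mul, ih, hrev.rep_simple,
      vertexMatrix_tau_rev_eq_sigma hΓ, heckeTInv_inv_simple_mul_of_lt cs s w h, map_mul, map_mul,
      map_mul]

/-- Inversion and transposition each reverse the order of factors, so together they preserve it.
Between consecutive factors `D * D = 1` cancels, and each letter contributes one `-u²`. -/
theorem vertexMatrix_rep_rev_eq_transpose (hΓ : Γ.IsWDigraph cs) (hrev : Γ.rev.IsWDigraph cs)
    (ε : V → ℤˣ) (hε : ∀ e ∈ Γ.edges, ε e.src = -ε e.tgt) (w : W) :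
    vertexMatrix (hrev.rep (heckeT cs w)) = Matrix.diagonal (fun α => ((ε α : ℤ) : QU)) *
      ((-qu ^ 2) ^ cs.length w • vertexMatrix (hΓ.rep (heckeTInv cs w))).transpose *
      Matrix.diagonal (fun α => ((ε α : ℤ) : QU)) := by
  have hD : Matrix.diagonal (fun α => ((ε α : ℤ) : QU)) *
      Matrix.diagonal (fun α => ((ε α : ℤ) : QU)) = 1 := by
    rw [Matrix.diagonal_mul_diagonal, ← Matrix.diagonal_one]
    congr 1
    funext α
    rw [← Int.cast_mul, ← Units.val_mul, Int.units_mul_self]; simp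
  induction w using coxeter_reduced_induction cs with
  | one =>
    simp only [heckeT_one, heckeTInv_one, map_one, cs.length_one, pow_zero, one_smul,
      Matrix.transpose_one, mul_one, hD]
  | step s w h ih =>
    have hl : cs.length (cs.simple s * w) = cs.length w + 1 := by
      have := cs.length_simple_mul w s
      omega
    rw [← heckeT_mul_of_lt cs s w h, map_mul, map_mul, ih, hrev.rep_simple,
      vertexMatrix_tau_rev_eq_transpose hΓ ε hε, heckeTInv_simple_mul_of_lt cs s w h, map_mul,
      map_mul, hl, pow_succ (-qu ^ 2), ← smul_mul_smul_comm, Matrix.transpose_mul]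
    simp only [mul_assoc]
    rw [← mul_assoc (Matrix.diagonal _) (Matrix.diagonal _), hD, one_mul]

theorem character_rev_eq_sigma (hΓ : Γ.IsWDigraph cs) (hrev : Γ.rev.IsWDigraph cs)
    (w : W) : hrev.character (heckeT cs w) = sigma (hΓ.character (heckeTInv cs w⁻¹)) := by
  rw [IsWDigraph.character, IsWDigraph.character, ← trace_vertexMatrix, ← trace_vertexMatrix,
    vertexMatrix_rep_rev hΓ hrev]
  exact (AddMonoidHom.map_trace (sigma : QU →+* QU) _).symm

theorem character_rev_eq_of_sign (hΓ : Γ.IsWDigraph cs) (hrev : Γ.rev.IsWDigraph cs)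
    (ε : V → ℤˣ) (hε : ∀ e ∈ Γ.edges, ε e.src = -ε e.tgt) (w : W) :
    hrev.character (heckeT cs w) =
      (-1) ^ cs.length w * qu ^ (2 * cs.length w) * hΓ.character (heckeTInv cs w) := by
  have hD : Matrix.diagonal (fun α => ((ε α : ℤ) : QU)) *
      Matrix.diagonal (fun α => ((ε α : ℤ) : QU)) = 1 := by
    rw [Matrix.diagonal_mul_diagonal, ← Matrix.diagonal_one]
    congr 1
    funext α
    rw [← Int.cast_mul, ← Units.val_mul, Int.units_mul_self]; simp
  -- Cyclicity of the trace brings the two sign matrices together, where they cancel.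
  rw [IsWDigraph.character, IsWDigraph.character, ← trace_vertexMatrix, ← trace_vertexMatrix,
    vertexMatrix_rep_rev_eq_transpose hΓ hrev ε hε, Matrix.trace_mul_cycle, hD, one_mul,
    Matrix.trace_transpose, Matrix.trace_smul, smul_eq_mul, neg_pow, pow_mul]

end Matrix

end LabeledDigraph

/-! ### Newman's lemma -/

/-- By well-founded induction: if `a` steps to `b` and to `c`, these have a common reduct `d`, and
any normal form of `d` is the unique one of `b` and the unique one of `c`. -/
theorem Relation.existsUnique_normalForm {X : Type*} {r : X → X → Prop}
    (wf : WellFounded (flip r))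
    (confl : ∀ a b c, r a b → r a c →
      ∃ d, Relation.ReflTransGen r b d ∧ Relation.ReflTransGen r c d) (a : X) :
    ∃! y, Relation.ReflTransGen r a y ∧ ∀ z, ¬ r y z := by
  induction a using wf.induction with
  | h a ih =>
    by_cases ha : ∃ b, r a b
    · obtain ⟨b, hb⟩ := ha
      obtain ⟨y, ⟨hy1, hy2⟩, hy3⟩ := ih b hb
      refine ⟨y, ⟨.head hb hy1, hy2⟩, ?_⟩
      rintro z ⟨hz1, hz2⟩
      rcases Relation.ReflTransGen.cases_head hz1 with rfl | ⟨c, hc, hz⟩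
      · exact absurd hb (hz2 _)
      · obtain ⟨d, hbd, hcd⟩ := confl a b c hb hc
        obtain ⟨x, ⟨hx1, hx2⟩, hx3⟩ := ih c hc
        -- `ih` speaks only of one-step reducts of `a`, and `d` may lie further away, so existence
        -- gets its own induction.
        have hnf : ∃ y', Relation.ReflTransGen r d y' ∧ ∀ z, ¬ r y' z := by
          have : ∀ d, ∃ y', Relation.ReflTransGen r d y' ∧ ∀ z, ¬ r y' z := by
            intro d
            induction d using wf.induction with
            | h d ihd =>
              by_cases h : ∃ e, r d e
              · obtain ⟨e, he⟩ := h
                obtain ⟨y', h1, h2⟩ := ihd e he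
                exact ⟨y', .head he h1, h2⟩
              · exact ⟨d, .refl, fun z hz => h ⟨z, hz⟩⟩
          exact this d
        obtain ⟨y', h1, h2⟩ := hnf
        rw [hx3 z ⟨hz, hz2⟩, ← hx3 y' ⟨hcd.trans h1, h2⟩, hy3 y' ⟨hbd.trans h1, h2⟩]
    · refine ⟨a, ⟨.refl, fun z hz => ha ⟨z, hz⟩⟩, ?_⟩
      rintro z ⟨hz1, -⟩
      rcases Relation.ReflTransGen.cases_head hz1 with rfl | ⟨c, hc, -⟩
      · rfl
      · exact absurd ⟨c, hc⟩ ha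

/-! ### Braid relations -/

section Braid

variable {S W : Type*} [Group W] {M : CoxeterMatrix S} (cs : CoxeterSystem M W)

theorem prod_map_heckeT_of_isReduced (ω : List S) (h : cs.IsReduced ω) :
    (ω.map fun s => heckeT cs (cs.simple s)).prod = heckeT cs (cs.wordProd ω) := by
  induction ω with
  | nil => simp [heckeT_one]
  | cons s ω ih =>
    have h' : cs.IsReduced ω := by simpa using h.drop 1
    rw [List.map_cons, List.prod_cons, ih h', heckeT_mul_of_lt, cs.wordProd_cons]
    rw [← cs.wordProd_cons, h.eq, h'.eq]
    simp

open CoxeterSystem in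
-- For `m = j + 1` the two products are `vt` and `av`, and the longer word spells `avt`. If it is
-- not reduced, `a` is a left descent of `vt`; were `av ≠ vt`, it would already be a left descent of
-- `v`, contradicting that the word for `av` is reduced.
theorem wordProd_alternatingWord_eq_swap {s t : S} {m : ℕ}
    (hs : cs.IsReduced (alternatingWord s t m)) (ht : cs.IsReduced (alternatingWord t s m))
    (h : ¬ cs.IsReduced (alternatingWord s t (m + 1))) :
    cs.wordProd (alternatingWord s t m) = cs.wordProd (alternatingWord t s m) := by
  obtain _ | j := m
  · rfl
  set a := if Even (j + 1) then t else s with ha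
  set v := cs.wordProd (alternatingWord t s j) with hv
  have hw : cs.wordProd (alternatingWord s t (j + 1)) = v * cs.simple t := by
    rw [alternatingWord_succ, cs.wordProd_concat]
  have hav : cs.wordProd (alternatingWord t s (j + 1)) = cs.simple a * v := by
    rw [alternatingWord_succ', cs.wordProd_cons]
    congr 2
    by_cases hj : Even j <;> simp [ha, hj, Nat.even_add_one]
  rw [hw, hav]
  by_contra hne
  have h1 : cs.IsLeftDescent (v * cs.simple t) a := by
    rw [cs.isLeftDescent_iff, ← hw]
    rw [CoxeterSystem.IsReduced, alternatingWord_succ', cs.wordProd_cons, ← ha] at h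
    have h2 := cs.length_simple_mul (cs.wordProd (alternatingWord s t (j + 1))) a
    have h3 := hs.eq
    simp only [List.length_cons, length_alternatingWord] at h h3
    omega
  rw [isLeftDescent_mul_simple_iff cs _ _ _ (Ne.symm hne), IsLeftDescent, ← hav, ht.eq] at h1
  have h4 := cs.length_wordProd_le (alternatingWord t s j)
  simp only [length_alternatingWord, ← hv] at h1 h4
  omega

open CoxeterSystem in
/-- If `st` has finite order, some element has reduced expressions in `s` and `t` ending in either
letter. -/
theorem exists_isReduced_concat (s t : S) (h : M s t ≠ 0) : ∃ ω₁ ω₂ : List S,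
    cs.IsReduced (ω₁ ++ [s]) ∧ cs.IsReduced (ω₂ ++ [t]) ∧ ω₁.length = ω₂.length ∧
      cs.wordProd (ω₁ ++ [s]) = cs.wordProd (ω₂ ++ [t]) := by
  classical
  let Q : ℕ → Prop := fun m =>
    cs.IsReduced (alternatingWord s t m) ∧ cs.IsReduced (alternatingWord t s m)
  -- The first length at which one of the two alternating words stops being reduced is used, so the
  -- exact order of `st` is not needed.
  have hex : ∃ m, ¬ Q m :=
    ⟨M s t + 1, fun hQ => cs.not_isReduced_alternatingWord s t h (by omega) hQ.1⟩
  have hQ0 : Q 0 := by simp [Q, CoxeterSystem.IsReduced, alternatingWord]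
  have hQ1 : Q 1 := by simp [Q, CoxeterSystem.IsReduced, alternatingWord]
  obtain ⟨m, hm⟩ : ∃ m, Nat.find hex = m + 2 := by
    have h0 : Nat.find hex ≠ 0 := fun h => Nat.find_spec hex (h ▸ hQ0)
    have h1 : Nat.find hex ≠ 1 := fun h => Nat.find_spec hex (h ▸ hQ1)
    exact ⟨Nat.find hex - 2, by omega⟩
  have hQ : Q (m + 1) := not_not.mp (Nat.find_min hex (by omega))
  have hnQ : ¬ Q (m + 2) := hm ▸ Nat.find_spec hex
  have heq : cs.wordProd (alternatingWord s t (m + 1)) =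
      cs.wordProd (alternatingWord t s (m + 1)) := by
    -- Whichever of the two words fails first, the same lemma applies with `s` and `t` possibly
    -- exchanged.
    rcases not_and_or.mp hnQ with h1 | h1
    · exact wordProd_alternatingWord_eq_swap cs hQ.1 hQ.2 h1
    · exact (wordProd_alternatingWord_eq_swap cs hQ.2 hQ.1 h1).symm
  have e1 : alternatingWord t s (m + 1) = alternatingWord s t m ++ [s] := by
    rw [alternatingWord_succ, List.concat_eq_append]
  have e2 : alternatingWord s t (m + 1) = alternatingWord t s m ++ [t] := by
    rw [alternatingWord_succ, List.concat_eq_append]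
  exact ⟨_, _, e1 ▸ hQ.2, e2 ▸ hQ.1, by simp, by rw [← e1, ← e2, heq]⟩

end Braid

/-! ### Reduction of `M(Γ)` modulo `u` -/

/-- The polynomials in `u` which are divisible by `u`, as a submodule of `ℚ(u)`. -/
noncomputable def quIdeal : Submodule (Polynomial ℚ) QU := Submodule.span _ {qu}

theorem mul_mem_quIdeal {a : QU} (ha : a ∈ quIdeal) (p : Polynomial ℚ) :
    a * algebraMap _ QU p ∈ quIdeal := by
  rw [mul_comm, ← Algebra.smul_def]
  exact quIdeal.smul_mem p ha

theorem qu_eq_algebraMap : qu = algebraMap (Polynomial ℚ) QU Polynomial.X :=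
  RatFunc.algebraMap_X.symm

theorem qu_mul_mem_quIdeal (p : Polynomial ℚ) : qu * algebraMap _ QU p ∈ quIdeal :=
  mul_mem_quIdeal (Submodule.mem_span_singleton_self qu) p

theorem single_mem_quIdeal {V : Type*} {a : QU} (ha : a ∈ quIdeal) (α β : V) :
    Finsupp.single α a β ∈ quIdeal := by
  classical
  rw [Finsupp.single_apply]
  split_ifs
  exacts [ha, zero_mem _]

/-- Evaluation at `u = 0` kills every multiple of `u` and keeps constants. -/
theorem eq_zero_of_intCast_mem_quIdeal {n : ℤ} (h : (n : QU) ∈ quIdeal) : n = 0 := by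
  obtain ⟨p, hp⟩ := Submodule.mem_span_singleton.mp h
  rw [Algebra.smul_def, qu_eq_algebraMap, ← map_mul, ← map_intCast (algebraMap (Polynomial ℚ) QU)]
    at hp
  have h1 := congrArg (Polynomial.eval 0) (RatFunc.algebraMap_injective ℚ hp)
  simpa using h1.symm

namespace LabeledDigraph

variable {S V : Type*} (Γ : LabeledDigraph S V)

/-- Polynomial entries mean that `τ_s` preserves the lattice of vectors with polynomial coordinates
and its multiples by `u`, so it can be specialized at `u = 0`. -/
theorem tauVertex_mem_range (s : S) (α β : V) :
    Γ.tauVertex s α β ∈ (algebraMap (Polynomial ℚ) QU).range := by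
  classical
  have hu : qu ∈ (algebraMap (Polynomial ℚ) QU).range := ⟨_, qu_eq_algebraMap.symm⟩
  have h1 := (algebraMap (Polynomial ℚ) QU).range.one_mem
  have h2 : ∀ (γ : V) (x : QU), x ∈ (algebraMap (Polynomial ℚ) QU).range →
      Finsupp.single γ x β ∈ (algebraMap (Polynomial ℚ) QU).range := by
    intro γ x hx
    rw [Finsupp.single_apply]
    split_ifs
    exacts [hx, zero_mem _]
  rw [← tau_single]
  obtain ⟨γ, k, h | h⟩ := Γ.exists_edge s α <;> cases k
  · rw [Γ.tau_src_solid h]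
    exact h2 _ _ h1
  · rw [Γ.tau_src_dashed h]
    exact add_mem (h2 _ _ hu) (h2 _ _ (add_mem hu h1))
  · rw [Γ.tau_tgt_solid h]
    exact add_mem (h2 _ _ (sub_mem (pow_mem hu 2) h1)) (h2 _ _ (pow_mem hu 2))
  · rw [Γ.tau_tgt_dashed h]
    exact add_mem (h2 _ _ (sub_mem (sub_mem (pow_mem hu 2) hu) h1))
      (h2 _ _ (sub_mem (pow_mem hu 2) hu))

theorem tau_mem_quIdeal (s : S) {x : V →₀ QU} (hx : ∀ α, x α ∈ quIdeal) (β : V) :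
    Γ.tau s x β ∈ quIdeal := by
  rw [tau, Finsupp.linearCombination_apply, Finsupp.sum_apply]
  refine quIdeal.sum_mem fun α _ => ?_
  obtain ⟨p, hp⟩ := Γ.tauVertex_mem_range s α β
  change x α * Γ.tauVertex s α β ∈ quIdeal
  rw [← hp]
  exact mul_mem_quIdeal (hx α) p

/-- The relation on signed vertices given by following an edge and changing the sign. -/
def SignedArc (x y : V × ℤˣ) : Prop := Γ.Arc x.1 y.1 ∧ y.2 = -x.2

variable {Γ}

/-- This symmetry makes the normal form of `(α, -1)` the negative of that of `(α, 1)`. -/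
theorem SignedArc.smul {x y : V × ℤˣ} (h : Γ.SignedArc x y) (e : ℤˣ) :
    Γ.SignedArc (x.1, e * x.2) (y.1, e * y.2) :=
  ⟨h.1, by simp [h.2]⟩

theorem reflTransGen_signedArc_smul {x y : V × ℤˣ} (h : Relation.ReflTransGen Γ.SignedArc x y)
    (e : ℤˣ) : Relation.ReflTransGen Γ.SignedArc (x.1, e * x.2) (y.1, e * y.2) :=
  h.lift (fun z => (z.1, e * z.2)) fun _ _ h => h.smul e

theorem tau_single_src_sub_mem {e : LabeledEdge S V} (he : e ∈ Γ.edges) (c : ℤ) (γ : V) :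
    (Γ.tau e.label (Finsupp.single e.src (c : QU)) - Finsupp.single e.tgt (c : QU)) γ
      ∈ quIdeal := by
  classical
  obtain ⟨α, β, s, k⟩ := e
  have hτ : Γ.tau s (Finsupp.single α (c : QU)) = (c : QU) • Γ.tau s (Finsupp.single α 1) := by
    rw [← map_smul, Finsupp.smul_single, smul_eq_mul, mul_one]
  simp only [hτ]
  cases k
  · rw [Γ.tau_src_solid he]
    simp
  · rw [Γ.tau_src_dashed he]
    -- For a dashed edge the remainder is `uc(α + β)`.
    have h1 : qu * (c : QU) ∈ quIdeal := by simpa using qu_mul_mem_quIdeal c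
    convert add_mem (single_mem_quIdeal h1 α γ) (single_mem_quIdeal h1 β γ) using 1
    simp [Finsupp.single_apply]
    split_ifs <;> ring

/-- Modulo `u`, the operator `-τ_s` fixes the target of every `s`-edge and sends its source to the
negative of its target. -/
theorem exists_tau_single_add_mem (s : S) (x : V × ℤˣ) : ∃ y : V × ℤˣ,
    Relation.ReflTransGen Γ.SignedArc x y ∧ ∀ γ, (Γ.tau s (Finsupp.single x.1 ((x.2 : ℤ) : QU)) +
      Finsupp.single y.1 ((y.2 : ℤ) : QU)) γ ∈ quIdeal := by
  classical
  obtain ⟨α, e⟩ := x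
  have hτ : Γ.tau s (Finsupp.single α ((e : ℤ) : QU)) =
      ((e : ℤ) : QU) • Γ.tau s (Finsupp.single α 1) := by
    rw [← map_smul, Finsupp.smul_single, smul_eq_mul, mul_one]
  simp only [hτ]
  obtain ⟨β, k, h | h⟩ := Γ.exists_edge s α
  · refine ⟨(β, -e), .single ⟨⟨_, h, rfl, rfl⟩, rfl⟩, fun γ => ?_⟩
    simpa [← hτ, sub_eq_add_neg] using tau_single_src_sub_mem h e γ
  -- At a target nothing moves: `τ_s α + α` is `u²(α + β)` for a solid edge and `(u² - u)(α + β)`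
  -- for a dashed one.
  · refine ⟨(α, e), .refl, fun γ => ?_⟩
    cases k
    · have h1 : qu ^ 2 * ((e : ℤ) : QU) ∈ quIdeal := by
        convert qu_mul_mem_quIdeal (Polynomial.X * ((e : ℤ) : Polynomial ℚ)) using 1
        rw [map_mul, ← qu_eq_algebraMap, map_intCast]
        ring
      rw [Γ.tau_tgt_solid h]
      convert add_mem (single_mem_quIdeal h1 α γ) (single_mem_quIdeal h1 β γ) using 1
      simp [Finsupp.single_apply]
      split_ifs <;> ring
    · have h1 : (qu ^ 2 - qu) * ((e : ℤ) : QU) ∈ quIdeal := by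
        convert qu_mul_mem_quIdeal ((Polynomial.X - 1) * ((e : ℤ) : Polynomial ℚ)) using 1
        rw [map_mul, map_sub, ← qu_eq_algebraMap, map_intCast, map_one]
        ring
      rw [Γ.tau_tgt_dashed h]
      convert add_mem (single_mem_quIdeal h1 α γ) (single_mem_quIdeal h1 β γ) using 1
      simp [Finsupp.single_apply]
      split_ifs <;> ring

/-- Iterates the previous lemma. As `-τ_s`, not `τ_s`, moves signed vertices, each letter costs a
factor `-1`. -/
theorem exists_prod_tau_single_sub_mem (ω : List S) (x : V × ℤˣ) : ∃ y : V × ℤˣ,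
    Relation.ReflTransGen Γ.SignedArc x y ∧
      ∀ γ, ((ω.map Γ.tau).prod (Finsupp.single x.1 ((x.2 : ℤ) : QU)) -
        (-1) ^ ω.length • Finsupp.single y.1 ((y.2 : ℤ) : QU)) γ ∈ quIdeal := by
  induction ω with
  | nil => exact ⟨x, .refl, by simp⟩
  | cons s ω ih =>
    obtain ⟨y, hy1, hy2⟩ := ih
    obtain ⟨z, hz1, hz2⟩ := exists_tau_single_add_mem (Γ := Γ) s y
    refine ⟨z, hy1.trans hz1, fun γ => ?_⟩
    have h1 := Γ.tau_mem_quIdeal s hy2 γ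
    rw [map_sub, map_zsmul] at h1
    have h2 := quIdeal.toAddSubgroup.zsmul_mem (hz2 γ) ((-1) ^ ω.length)
    rw [← Finsupp.smul_apply] at h2
    convert add_mem h1 h2 using 1
    rw [← Finsupp.add_apply, smul_add, ← add_assoc, sub_add_cancel, List.map_cons, List.prod_cons,
      Module.End.mul_apply, List.length_cons, pow_succ, mul_neg_one, neg_smul, sub_neg_eq_add]

/-- Signed vertices stay distinct modulo `u`: the coefficient at the vertex of `x` is an integer,
hence zero if divisible by `u`. -/
theorem eq_of_single_sub_single_mem {x y : V × ℤˣ}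
    (h : ∀ γ, (Finsupp.single x.1 ((x.2 : ℤ) : QU) - Finsupp.single y.1 ((y.2 : ℤ) : QU)) γ
      ∈ quIdeal) : x = y := by
  obtain ⟨α, e⟩ := x
  obtain ⟨β, f⟩ := y
  have h1 := h α
  by_cases hαβ : β = α
  · subst hαβ
    simp only [Finsupp.sub_apply, Finsupp.single_eq_same, ← Int.cast_sub] at h1
    rw [Units.ext (sub_eq_zero.mp (eq_zero_of_intCast_mem_quIdeal h1))]
  · rw [Finsupp.sub_apply, Finsupp.single_eq_same, Finsupp.single_eq_of_ne (Ne.symm hαβ),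
      sub_zero] at h1
    exact absurd (eq_zero_of_intCast_mem_quIdeal h1) e.ne_zero

/-! ### Confluence of signed arcs and the sign function -/

variable {W : Type*} [Group W] {M : CoxeterMatrix S} {cs : CoxeterSystem M W}

theorem IsWDigraph.prod_map_tau (hΓ : Γ.IsWDigraph cs) (ω : List S) (h : cs.IsReduced ω) :
    (ω.map Γ.tau).prod = hΓ.rep (heckeT cs (cs.wordProd ω)) := by
  rw [← prod_map_heckeT_of_isReduced cs ω h, map_list_prod, List.map_map]
  congr 2
  funext s
  exact (hΓ.rep_simple s).symm

theorem prod_map_tau_mem_quIdeal (ω : List S) {x : V →₀ QU} (hx : ∀ α, x α ∈ quIdeal) (β : V) :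
    (ω.map Γ.tau).prod x β ∈ quIdeal := by
  induction ω generalizing β with
  | nil => exact hx β
  | cons s ω ih => exact Γ.tau_mem_quIdeal s ih β

/-- Following an edge labeled `s` is the first step in applying a word ending in `s`. -/
theorem exists_prod_concat_tau_single_sub_mem {e : LabeledEdge S V} (he : e ∈ Γ.edges)
    (ω : List S) (c : ℤˣ) : ∃ y : V × ℤˣ,
    Relation.ReflTransGen Γ.SignedArc (e.tgt, c) y ∧
      ∀ γ, (((ω ++ [e.label]).map Γ.tau).prod (Finsupp.single e.src ((c : ℤ) : QU)) -
        (-1) ^ ω.length • Finsupp.single y.1 ((y.2 : ℤ) : QU)) γ ∈ quIdeal := by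
  obtain ⟨y, hy1, hy2⟩ := exists_prod_tau_single_sub_mem ω (e.tgt, c)
  refine ⟨y, hy1, fun γ => ?_⟩
  have h := add_mem (prod_map_tau_mem_quIdeal (Γ := Γ) ω (tau_single_src_sub_mem he c) γ) (hy2 γ)
  simpa using h

/-- Both edges leave the same source. Two reduced words for one element, ending in the two labels,
act as the same operator; modulo `u` the first letter applied crosses the respective edge and the
rest follows signed arcs, so both paths end at the same signed vertex. -/
theorem signedArc_locally_confluent (hΓ : Γ.IsWDigraph cs) (hM : ∀ s t : S, M s t ≠ 0)
    (x y z : V × ℤˣ) (hy : Γ.SignedArc x y) (hz : Γ.SignedArc x z) :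
    ∃ v, Relation.ReflTransGen Γ.SignedArc y v ∧ Relation.ReflTransGen Γ.SignedArc z v := by
  obtain ⟨α, c⟩ := x
  obtain ⟨_, d⟩ := y
  obtain ⟨_, d'⟩ := z
  obtain ⟨⟨e, he, rfl, rfl⟩, rfl : d = -c⟩ := hy
  obtain ⟨⟨f, hf, hfe : f.src = e.src, rfl⟩, rfl : d' = -c⟩ := hz
  obtain ⟨ω₁, ω₂, h1, h2, hl, hw⟩ := exists_isReduced_concat cs e.label f.label (hM _ _)
  -- `τ_s` carries source to target without a sign, so reaching `(e.tgt, -c)` means starting from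
  -- `-c` times the source.
  obtain ⟨y, hy1, hy2⟩ := exists_prod_concat_tau_single_sub_mem he ω₁ (-c)
  obtain ⟨z, hz1, hz2⟩ := exists_prod_concat_tau_single_sub_mem hf ω₂ (-c)
  rw [hΓ.prod_map_tau _ h1, hw] at hy2
  rw [hΓ.prod_map_tau _ h2, hfe, ← hl] at hz2
  have hyz : y = z := by
    apply eq_of_single_sub_single_mem
    intro γ
    -- Equal word lengths give both sides the same factor `(-1) ^ ω₁.length`, which is cleared here.
    have h := quIdeal.toAddSubgroup.zsmul_mem (sub_mem (hz2 γ) (hy2 γ)) ((-1) ^ ω₁.length)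
    rw [← Finsupp.sub_apply, sub_sub_sub_cancel_left, ← smul_sub, ← Finsupp.smul_apply, smul_smul,
      ← mul_pow, neg_one_mul, neg_neg, one_pow, one_smul] at h
    exact h
  exact ⟨y, hy1, hyz ▸ hz1⟩

/-- The vertices can be given signs such that the ends of each edge have opposite signs. -/
theorem exists_sign [Finite V] (hΓ : Γ.IsWDigraph cs) (hM : ∀ s t : S, M s t ≠ 0)
    (hA : Γ.Acyclic) : ∃ ε : V → ℤˣ, ∀ e ∈ Γ.edges, ε e.src = -ε e.tgt := by
  have wfArc : WellFounded (flip Γ.Arc) := by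
    -- Acyclicity says that the transitive closure of `Γ.Arc` is irreflexive, hence well-founded in
    -- either direction on a finite set.
    let r : V → V → Prop := fun a b => Relation.TransGen Γ.Arc b a
    have : IsTrans V r := ⟨fun a b c h1 h2 => h2.trans h1⟩
    have : Std.Irrefl r := ⟨hA⟩
    exact Subrelation.wf (r := r) (fun h => Relation.TransGen.single h)
      (Finite.wellFounded_of_trans_of_irrefl r)
  have wf : WellFounded (flip Γ.SignedArc) :=
    Subrelation.wf (fun h => h.1) (InvImage.wf Prod.fst wfArc)
  have hnf := Relation.existsUnique_normalForm wf (signedArc_locally_confluent hΓ hM)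
  choose nf h1 h2 using hnf
  refine ⟨fun α => (nf (α, 1)).2, fun e he => ?_⟩
  have hstep : Γ.SignedArc (e.src, 1) (e.tgt, -1) := ⟨⟨e, he, rfl, rfl⟩, rfl⟩
  -- `(e.src, 1)` steps to `(e.tgt, -1)`, which reduces to the negative of the normal form of
  -- `(e.tgt, 1)`; uniqueness identifies this with the normal form of `(e.src, 1)`.
  have h3 := h2 (e.src, 1) ((nf (e.tgt, 1)).1, -1 * (nf (e.tgt, 1)).2) ⟨.head hstep ?_, ?_⟩
  · simp [← h3]
  · simpa using reflTransGen_signedArc_smul (h1 (e.tgt, 1)).1 (-1)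
  · intro z hz
    exact (h1 (e.tgt, 1)).2 (z.1, -1 * z.2) (by simpa using hz.smul (-1))

end LabeledDigraph

theorem theorem9 {S W V : Type*} [Group W] {M : CoxeterMatrix S} (cs : CoxeterSystem M W)
    [Finite V] (Γ : LabeledDigraph S V) (hΓ : Γ.IsWDigraph cs) :
    ∃ hrev : Γ.rev.IsWDigraph cs,
      (∀ w : W, hrev.character (heckeT cs w) = sigma (hΓ.character (heckeTInv cs w⁻¹))) ∧
      ((∀ s t : S, M s t ≠ 0) → Γ.Acyclic →
        ∀ w : W, hrev.character (heckeT cs w) =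
          (-1) ^ cs.length w * qu ^ (2 * cs.length w) * hΓ.character (heckeTInv cs w)) := by
  classical
  have := Fintype.ofFinite V
  have hrev := LabeledDigraph.isWDigraph_rev hΓ
  refine ⟨hrev, LabeledDigraph.character_rev_eq_sigma hΓ hrev, fun hM hA => ?_⟩
  obtain ⟨ε, hε⟩ := LabeledDigraph.exists_sign hΓ hM hA
  exact LabeledDigraph.character_rev_eq_of_sign hΓ hrev ε hε
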